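/- Let $K\ge 0$ and let $g:\mathbb{R}\to[0,\infty)$ be a Lipschitz continuous probability density. Put $\widehat g(\tau)=\int_{\mathbb{R}}g(\omega)e^{-i\tau\omega}\,d\omega$ and assume that $\int_0^{\infty}(1+\tau)|\widehat g(\tau)|\,d\tau<+\infty$. Suppose that the stability condition of the homogeneous state $\frac{g(\omega)}{2\pi}d\theta\,d\omega$ fails in the open right half-plane, i.e. there is $z\in\mathbb{C}$ with $\mathrm{Re}(z)>0$ and $$\frac K2\int_0^{\infty}\widehat g(\tau)e^{-z\tau}\,d\tau=1 .$$ Then there exists a partially locked state, of some global frequency $\Omega\in\mathbb{R}$, with frequency marginal $g(\omega)\,d\omega$ and profile of type $f_{\mathrm s}$, for the Kuramoto equation on $\mathbb{T}^1\times\mathbb{R}$ ($\mathbb{T}^1=\mathbb{R}/2\pi\mathbb{Z}$) $$\partial_t f+\partial_\theta\big(fV[f]\big)=0,\qquad V[f](\theta,\omega)=\omega+K\int_{\mathbb{T}^1\times\mathbb{R}}\sin(\theta'-\theta)\,f(d\theta',d\omega').$$ Explicitly: there are $\Omega\in\mathbb{R}$ and $r>0$ such that the measure $f$ on $\mathbb{T}^1\times\mathbb{R}$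 given by $$f(\theta,\omega)=\begin{cases}\delta_{\arcsin\left(\frac{\omega-\Omega}{Kr}\right)}(\theta)\,g(\omega)&\text{if }|\omega-\Omega|\le Kr,\\[4pt] \dfrac{\sqrt{(\omega-\Omega)^2-(Kr)^2}}{2\pi\,|\omega-\Omega-Kr\sin\theta|}\,g(\omega)&\text{if }|\omega-\Omega|>Kr\end{cases}$$ is a probability measure with frequency marginal $g(\omega)\,d\omega$ and order parameter $\int e^{i\theta}f(d\theta,d\omega)=r\neq0$, and such that $t\mapsto R_{\Omega t}f$, $t\ge0$, is a weak (measure-valued) solution of the Kuramoto equation, where $R_{\Theta}$ is the action on measures of the rotation $(\theta,\omega)\mapsto(\theta+\Theta,\omega)$. The frequency $\Omega$ is not required to vanish, even if $g$ is symmetric. -/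

import Mathlib

open MeasureTheory Set

noncomputable section

namespace Kuramoto

/-- The unit circle `ℝ / 2πℤ`. Its `volume` is the Lebesgue measure `dθ`, of total mass `2π`. -/
abbrev T1 : Type := AddCircle (2 * Real.pi)

instance factTwoPiPos : Fact (0 < 2 * Real.pi) := ⟨Real.two_pi_pos⟩

/-- The cylinder: pairs `(θ, ω)` of a phase and a natural frequency. -/
abbrev Cyl : Type := T1 × ℝ

/-- The sine of an element of the circle. -/
def sinT (θ : T1) : ℝ := Real.Angle.sin θ

/-- `e^{iθ}` for `θ` in the circle. -/
def expT (θ : T1) : ℂ := (Real.Angle.toCircle θ : ℂ)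

/-- The complex order parameter `∫ e^{iθ} f(dθ, dω)`. -/
def orderParameter (f : Measure Cyl) : ℂ := ∫ p, expT p.1 ∂f

/-- The velocity field `V[f](θ, ω) = ω + K ∫ sin(θ' - θ) f(dθ', dω')`. -/
def velocity (K : ℝ) (f : Measure Cyl) (p : Cyl) : ℝ :=
  p.2 + K * ∫ q, sinT (q.1 - p.1) ∂f

/-- The partial derivative in the angle of a function on the cylinder. -/
def angleDeriv (φ : Cyl → ℝ) (p : Cyl) : ℝ :=
  deriv (fun s : ℝ => φ (p.1 + (s : T1), p.2)) 0

/-- Test functions: compactly supported functions of class `C¹` on the cylinder. -/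
def IsTestFunction (φ : Cyl → ℝ) : Prop :=
  ContDiff ℝ 1 (fun p : ℝ × ℝ => φ ((p.1 : T1), p.2)) ∧ HasCompactSupport φ

/-- Weak (measure-valued) solutions, for times `t ≥ 0`, of the Kuramoto equation
`∂ₜ f + ∂_θ (f V[f]) = 0`: probability measures `f t` on the cylinder such that
`d/dt ∫ φ df(t) = ∫ V[f(t)] ∂_θ φ df(t)` for every test function `φ`. -/
def IsWeakSolution (K : ℝ) (f : ℝ → Measure Cyl) : Prop :=
  (∀ t : ℝ, 0 ≤ t → IsProbabilityMeasure (f t)) ∧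
  ∀ φ : Cyl → ℝ, IsTestFunction φ → ∀ t : ℝ, 0 ≤ t →
    HasDerivWithinAt (fun s : ℝ => ∫ p, φ p ∂(f s))
      (∫ p, velocity K (f t) p * angleDeriv φ p ∂(f t)) (Ici 0) t

/-- The action `R_{Θ,Ω}` on measures of the map `(θ, ω) ↦ (θ + Θ, ω + Ω)`. -/
def galilean (Θ : T1) (Ω : ℝ) (f : Measure Cyl) : Measure Cyl :=
  f.map (fun p : Cyl => (p.1 + Θ, p.2 + Ω))

/-- `f` is the reference measure of a partially locked state of global frequency `Ω`:
`t ↦ R_{Ω t} f` solves the Kuramoto equation, and the order parameter of `f` is not zero. -/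
def IsPLS (K Ω : ℝ) (f : Measure Cyl) : Prop :=
  IsWeakSolution K (fun t => galilean ((Ω * t : ℝ) : T1) 0 f) ∧ orderParameter f ≠ 0

/-- The frequency marginal of a measure on the cylinder. -/
def frequencyMarginal (f : Measure Cyl) : Measure ℝ := f.map Prod.snd

/-- The measure `g(ω) dω`. -/
def densityMeasure (g : ℝ → ℝ) : Measure ℝ := volume.withDensity (fun ω => ENNReal.ofReal (g ω))

/-- The locked part of the profile `f_s` (with `a = K r`):
`δ_{arcsin (ω/a)}(θ) g(ω)` on `|ω| ≤ a`. -/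
def lockedPart (a : ℝ) (g : ℝ → ℝ) : Measure Cyl :=
  ((densityMeasure g).restrict {ω : ℝ | |ω| ≤ a}).map
    (fun ω : ℝ => (((Real.arcsin (ω / a) : ℝ) : T1), ω))

/-- The drifting part of the profile `f_s` (with `a = K r`):
the density `√(ω² - a²) / (2π |ω - a sin θ|) g(ω)` on `|ω| > a`. -/
def driftingPart (a : ℝ) (g : ℝ → ℝ) : Measure Cyl :=
  ((volume : Measure Cyl).restrict {p : Cyl | a < |p.2|}).withDensity
    (fun p => ENNReal.ofReal
      (Real.sqrt (p.2 ^ 2 - a ^ 2) / (2 * Real.pi * |p.2 - a * sinT p.1|) * g p.2))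

/-- The stationary profile `f_s` of marginal density `g`, with `a = K r`. -/
def fs (a : ℝ) (g : ℝ → ℝ) : Measure Cyl := lockedPart a g + driftingPart a g

/-- The profile of type `f_s` for global frequency `Ω` and marginal density `g`: in the frame
rotating with frequency `Ω` the marginal density is `ω ↦ g (ω + Ω)`, and the resulting
stationary profile is moved back by `R_{0,Ω}`. -/
def rotatingFs (a Ω : ℝ) (g : ℝ → ℝ) : Measure Cyl :=
  galilean 0 Ω (fs a (fun ω => g (ω + Ω)))

/-- The Fourier transform `ĝ(τ) = ∫ g(ω) e^{-iτω} dω`. -/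
def fourier (g : ℝ → ℝ) (τ : ℝ) : ℂ :=
  ∫ ω : ℝ, (g ω : ℂ) * Complex.exp (-(Complex.I * τ * ω))

/-- The stability condition of the homogeneous state at the point `z`:
`(K/2) ∫_{ℝ⁺} ĝ(τ) e^{-zτ} dτ ≠ 1`. -/
def StabHomogAt (K : ℝ) (g : ℝ → ℝ) (z : ℂ) : Prop :=
  (K / 2 : ℂ) * ∫ τ in Ioi (0 : ℝ), fourier g τ * Complex.exp (-(z * τ)) ≠ 1

end Kuramoto

end

/-!
Write `μ = g(ω) dω`. An oscillator of frequency `Ω + x` driven by a field of strength `a = K r` has,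
under the profile `f_s`, the mean phase factor `meanPhase a x`, and the proposed measure is a
partially locked state as soon as its order parameter equals `r`, that is, as soon as
`∫ meanPhase a (ω - Ω) dμ(ω) = a / K`.

This equation is holomorphic in disguise: `meanPhase a x` is `a` times the conjugate of the boundary
value at `ζ = ix` of the kernel `lockKernel a ζ = (√(ζ² + a²) - ζ) / a²`, holomorphic on `Re ζ > 0`
and continuous up to the boundary for `a > 0`. With
`lockTransform μ a z = ∫ lockKernel a (z + iω) dμ(ω)` the equation becomes
`lockTransform μ a (-iΩ) = 1 / K`. At `a = 0` the kernel is the Cauchy kernel `1 / (2ζ)`, so that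
the failure of the stability condition at `z` says exactly `lockTransform μ 0 z = 1 / K`
(`integral_fourier_mul_exp`).

One then follows the solutions `z`, `Re z > 0`, of `lockTransform μ a z = 1 / K` as `a` grows from
`0` (`exists_lockTransform_eq_on_boundary`). The set of `a ≥ 0` for which such a solution exists
contains `0`, and is bounded by `K` since `|lockTransform μ a z| ≤ 1 / a`. It has no greatest
element, because zeros of holomorphic functions persist under perturbation
(`eventually_exists_lockTransform_eq`). At its supremum `a > 0` the solutions still converge along
a subsequence, because the transform vanishes at infinity uniformly for `a` away from `0`
(`exists_forall_norm_lockTransform_lt`); the limit cannot lie in the open half-plane, hence it is a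
point `-iΩ` of the imaginary axis.

On the measure side, `f_s` is the composition of the frequency distribution with a Markov kernel
`phaseKernel a` (`fs_eq_map_compProd`), whose drifting part is the Poisson kernel of the unit disc
at the point `meanPhase a x`. Its total mass and its mean phase factor are the Poisson integrals of `1`
and `z`. In the rotating frame the angular velocity `x - a sin θ` vanishes on the locked part and has
constant flux on the drifting part, which gives the weak formulation (`integral_flux_phaseKernel`,
`isWeakSolution_rotatingFs`).
-/

noncomputable section

namespace Kuramoto

open Filter Topology Complex ProbabilityTheory

/-! ### Square roots and the locking kernel -/

/-- `√(ζ - ia) + √(ζ + ia)`, with principal square roots. Both radicands stay in the closed right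
half-plane when `ζ` does, so that no branch cut is met, in contrast to `√(ζ² + a²)`. -/
def sqrtSum (a : ℝ) (ζ : ℂ) : ℂ :=
  (ζ - a * I) ^ (2⁻¹ : ℂ) + (ζ + a * I) ^ (2⁻¹ : ℂ)

/-- The kernel `(√(ζ² + a²) - ζ) / a²` on the right half-plane, written as
`2 / (√(ζ - ia) + √(ζ + ia))²` so that it makes sense for `a = 0` as well. -/
def lockKernel (a : ℝ) (ζ : ℂ) : ℂ := 2 / sqrtSum a ζ ^ 2

lemma cpow_half_sq (x : ℂ) : (x ^ (2⁻¹ : ℂ)) ^ 2 = x := by simp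

lemma norm_cpow_half_sq (x : ℂ) : ‖x ^ (2⁻¹ : ℂ)‖ ^ 2 = ‖x‖ := by
  rw [← norm_pow, cpow_half_sq]

lemma cpow_half_re_nonneg (x : ℂ) : 0 ≤ (x ^ (2⁻¹ : ℂ)).re := by
  rw [cpow_inv_two_re]; positivity

lemma abs_im_cpow_half_le {x : ℂ} (hx : 0 ≤ x.re) :
    |(x ^ (2⁻¹ : ℂ)).im| ≤ (x ^ (2⁻¹ : ℂ)).re := by
  refine abs_le_of_sq_le_sq ?_ (cpow_half_re_nonneg x)
  have h := congrArg Complex.re (cpow_half_sq x)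
  rw [pow_two, mul_re] at h
  nlinarith

/-- The square roots of two points of the right half-plane make an angle of at most `π / 2`, so the
square of the norm of their sum dominates the sum of the squares. -/
lemma norm_add_norm_le_norm_sqrtSum_sq (a : ℝ) {ζ : ℂ} (hζ : 0 ≤ ζ.re) :
    ‖ζ - a * I‖ + ‖ζ + a * I‖ ≤ ‖sqrtSum a ζ‖ ^ 2 := by
  have h1 : 0 ≤ (ζ - a * I).re := by simpa using hζ
  have h2 : 0 ≤ (ζ + a * I).re := by simpa using hζ
  rw [← norm_cpow_half_sq (ζ - a * I), ← norm_cpow_half_sq (ζ + a * I), sqrtSum]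
  have k1 := abs_im_cpow_half_le h1
  have k2 := abs_im_cpow_half_le h2
  set p := (ζ - a * I) ^ (2⁻¹ : ℂ)
  set q := (ζ + a * I) ^ (2⁻¹ : ℂ)
  rw [← normSq_eq_norm_sq, ← normSq_eq_norm_sq, ← normSq_eq_norm_sq, normSq_add]
  have h3 : 0 ≤ (p * (starRingEnd ℂ) q).re := by
    have h4 := mul_le_mul k1 k2 (abs_nonneg _) ((abs_nonneg _).trans k1)
    rw [← abs_mul] at h4
    have := neg_abs_le (p.im * q.im)
    simp only [mul_re, conj_re, conj_im]
    linarith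
  linarith

lemma two_mul_norm_le (a : ℝ) {ζ : ℂ} (hζ : 0 ≤ ζ.re) :
    2 * ‖ζ‖ ≤ ‖sqrtSum a ζ‖ ^ 2 := by
  refine le_trans ?_ (norm_add_norm_le_norm_sqrtSum_sq a hζ)
  have := norm_add_le (ζ - a * I) (ζ + a * I)
  rwa [show ζ - a * I + (ζ + a * I) = 2 * ζ by ring, norm_mul, Complex.norm_two] at this

lemma two_mul_abs_le (a : ℝ) {ζ : ℂ} (hζ : 0 ≤ ζ.re) :
    2 * |a| ≤ ‖sqrtSum a ζ‖ ^ 2 := by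
  refine le_trans ?_ (norm_add_norm_le_norm_sqrtSum_sq a hζ)
  have := norm_sub_le (ζ + a * I) (ζ - a * I)
  rw [show ζ + a * I - (ζ - a * I) = 2 * (a * I) by ring, norm_mul, Complex.norm_two, norm_mul,
    norm_I, mul_one, norm_real, Real.norm_eq_abs] at this
  linarith

lemma norm_lockKernel (a : ℝ) (ζ : ℂ) : ‖lockKernel a ζ‖ = 2 / ‖sqrtSum a ζ‖ ^ 2 := by
  simp [lockKernel]

lemma norm_lockKernel_le {a : ℝ} (ha : 0 < a) {ζ : ℂ} (hζ : 0 ≤ ζ.re) :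
    ‖lockKernel a ζ‖ ≤ 1 / a := by
  have h := two_mul_abs_le a hζ
  rw [abs_of_pos ha] at h
  rw [norm_lockKernel, div_le_div_iff₀ (by linarith) ha]
  linarith

lemma norm_lockKernel_le' (a : ℝ) {ζ : ℂ} (hζ : 0 ≤ ζ.re) (h0 : ζ ≠ 0) :
    ‖lockKernel a ζ‖ ≤ 1 / ‖ζ‖ := by
  have h := two_mul_norm_le a hζ
  have h0 := norm_pos_iff.2 h0
  rw [norm_lockKernel, div_le_div_iff₀ (by linarith) h0]
  linarith

lemma sqrtSum_ne_zero {a : ℝ} {ζ : ℂ} (hζ : 0 ≤ ζ.re) (h : 0 < a ∨ 0 < ζ.re) :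
    sqrtSum a ζ ≠ 0 := by
  intro h0
  have h1 := two_mul_norm_le a hζ
  have h2 := two_mul_abs_le a hζ
  rw [h0, norm_zero] at h1 h2
  rcases h with h | h
  · rw [abs_of_pos h] at h2
    linarith
  · have := re_le_norm ζ
    linarith

lemma continuousAt_sqrtSum {a : ℝ} {ζ : ℂ} (hζ : 0 ≤ ζ.re) :
    ContinuousAt (fun p : ℝ × ℂ => sqrtSum p.1 p.2) (a, ζ) := by
  unfold sqrtSum
  have h1 : ContinuousAt (fun x : ℂ => x ^ (2⁻¹ : ℂ)) (ζ - a * I) :=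
    continuousAt_cpow_const_of_re_pos (by simpa using Or.inl hζ) (by norm_num)
  have h2 : ContinuousAt (fun x : ℂ => x ^ (2⁻¹ : ℂ)) (ζ + a * I) :=
    continuousAt_cpow_const_of_re_pos (by simpa using Or.inl hζ) (by norm_num)
  refine ContinuousAt.add ?_ ?_
  · exact ContinuousAt.comp (f := fun p : ℝ × ℂ => p.2 - p.1 * I) (x := (a, ζ)) h1
      (by fun_prop)
  · exact ContinuousAt.comp (f := fun p : ℝ × ℂ => p.2 + p.1 * I) (x := (a, ζ)) h2
      (by fun_prop)

lemma continuousAt_lockKernel {a : ℝ} {ζ : ℂ} (hζ : 0 ≤ ζ.re) (h : 0 < a ∨ 0 < ζ.re) :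
    ContinuousAt (fun p : ℝ × ℂ => lockKernel p.1 p.2) (a, ζ) :=
  continuousAt_const.div ((continuousAt_sqrtSum hζ).pow 2) (pow_ne_zero 2 (sqrtSum_ne_zero hζ h))

lemma hasDerivAt_cpow_half {x : ℂ} (hx : 0 < x.re) :
    HasDerivAt (fun x : ℂ => x ^ (2⁻¹ : ℂ)) (1 / (2 * x ^ (2⁻¹ : ℂ))) x := by
  have h0 : x ≠ 0 := by rintro rfl; simp at hx
  have h := (hasDerivAt_id x).cpow_const (c := (2⁻¹ : ℂ)) (Or.inl hx)
  refine h.congr_deriv ?_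
  have h1 : x ^ (2⁻¹ : ℂ) ≠ 0 := by simp [h0]
  change (2⁻¹ : ℂ) * x ^ ((2⁻¹ : ℂ) - 1) * 1 = _
  rw [cpow_sub _ _ h0, cpow_one, mul_one]
  have h2 := cpow_half_sq x
  generalize x ^ (2⁻¹ : ℂ) = y at h1 h2
  rw [← h2]
  field_simp

/-- The derivative of the kernel is `- lockKernel a ζ / √(ζ² + a²)`. -/
lemma hasDerivAt_lockKernel (a : ℝ) {ζ : ℂ} (hζ : 0 < ζ.re) :
    HasDerivAt (lockKernel a)
      (-lockKernel a ζ / ((ζ - a * I) ^ (2⁻¹ : ℂ) * (ζ + a * I) ^ (2⁻¹ : ℂ))) ζ := by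
  have h1 : 0 < (ζ - a * I).re := by simpa using hζ
  have h2 : 0 < (ζ + a * I).re := by simpa using hζ
  have n1 : (ζ - a * I) ^ (2⁻¹ : ℂ) ≠ 0 := by
    have : ζ - a * I ≠ 0 := fun h => by simp [h] at h1
    simp [this]
  have n2 : (ζ + a * I) ^ (2⁻¹ : ℂ) ≠ 0 := by
    have : ζ + a * I ≠ 0 := fun h => by simp [h] at h2
    simp [this]
  have n3 := sqrtSum_ne_zero (a := a) hζ.le (Or.inr hζ)
  have d1 : HasDerivAt (fun z : ℂ => (z - a * I) ^ (2⁻¹ : ℂ)) _ ζ :=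
    (hasDerivAt_cpow_half h1).comp_sub_const ζ _
  have d2 : HasDerivAt (fun z : ℂ => (z + a * I) ^ (2⁻¹ : ℂ)) _ ζ :=
    (hasDerivAt_cpow_half h2).comp_add_const ζ _
  have d3 : HasDerivAt (sqrtSum a) _ ζ := d1.add d2
  have d4 : HasDerivAt (lockKernel a) _ ζ :=
    (hasDerivAt_const ζ (2 : ℂ)).div (d3.pow 2) (pow_ne_zero 2 n3)
  refine d4.congr_deriv ?_
  unfold lockKernel
  unfold sqrtSum at n3 ⊢
  generalize (ζ - a * I) ^ (2⁻¹ : ℂ) = p at *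
  generalize (ζ + a * I) ^ (2⁻¹ : ℂ) = q at *
  field_simp
  push_cast
  ring

lemma norm_deriv_lockKernel_le (a : ℝ) {ζ : ℂ} {c : ℝ} (hc : 0 < c) (hζ : c ≤ ζ.re) :
    ‖-lockKernel a ζ / ((ζ - a * I) ^ (2⁻¹ : ℂ) * (ζ + a * I) ^ (2⁻¹ : ℂ))‖ ≤ 1 / c * (1 / c) := by
  have h1 : c ≤ ‖(ζ - a * I) ^ (2⁻¹ : ℂ)‖ ^ 2 := by
    rw [norm_cpow_half_sq]
    exact le_trans (by simpa using hζ) (re_le_norm _)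
  have h2 : c ≤ ‖(ζ + a * I) ^ (2⁻¹ : ℂ)‖ ^ 2 := by
    rw [norm_cpow_half_sq]
    exact le_trans (by simpa using hζ) (re_le_norm _)
  have h3 : ‖lockKernel a ζ‖ ≤ 1 / c := by
    have h0 : ζ ≠ 0 := fun h => by simp [h] at hζ; linarith
    refine (norm_lockKernel_le' a (hc.le.trans hζ) h0).trans ?_
    exact one_div_le_one_div_of_le hc (hζ.trans (re_le_norm _))
  rw [norm_div, norm_neg, div_eq_mul_one_div]
  gcongr
  rw [norm_mul]
  refine abs_le_of_sq_le_sq' (a := c) ?_ (by positivity) |>.2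
  rw [mul_pow, pow_two]
  gcongr

/-- For `a = 0` the kernel is the Cauchy kernel `1 / (2ζ)`. -/
lemma lockKernel_zero (ζ : ℂ) : lockKernel 0 ζ = 1 / (2 * ζ) := by
  have : sqrtSum 0 ζ ^ 2 = 4 * ζ := by
    have := cpow_half_sq ζ
    simp only [sqrtSum, ofReal_zero, zero_mul, sub_zero, add_zero]
    linear_combination 4 * this
  rw [lockKernel, this]
  by_cases h : ζ = 0
  · simp [h]
  · field_simp; norm_num

/-! ### Locking solutions persist up to the boundary of the half-plane -/

/-- The transform `z ↦ ∫ lockKernel a (z + iω) dμ(ω)`. For `a > 0` its values on the imaginary axis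
give the order parameter of the partially locked profiles of field strength `a`. -/
def lockTransform (μ : Measure ℝ) (a : ℝ) (z : ℂ) : ℂ := ∫ ω : ℝ, lockKernel a (z + I * ω) ∂μ

variable {μ : Measure ℝ}

lemma continuous_lockKernel_line {a : ℝ} {z : ℂ} (hz : 0 ≤ z.re) (h : 0 < a ∨ 0 < z.re) :
    Continuous (fun ω : ℝ => lockKernel a (z + I * ω)) := by
  refine continuous_iff_continuousAt.2 fun ω => ?_
  have h1 := continuousAt_lockKernel (a := a) (ζ := z + I * ω) (by simpa using hz) (by simpa using h)
  exact ContinuousAt.comp (f := fun ω : ℝ => ((a, z + I * ω) : ℝ × ℂ)) (x := ω) h1 (by fun_prop)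

lemma norm_lockKernel_le_of_le_re (a : ℝ) {ζ : ℂ} {c : ℝ} (hc : 0 < c) (hζ : c ≤ ζ.re) :
    ‖lockKernel a ζ‖ ≤ 1 / c := by
  have h0 : ζ ≠ 0 := fun h => by simp [h] at hζ; linarith
  exact (norm_lockKernel_le' a (hc.le.trans hζ) h0).trans
    (one_div_le_one_div_of_le hc (hζ.trans (re_le_norm _)))

lemma norm_lockTransform_le [IsProbabilityMeasure μ] {a : ℝ} (ha : 0 < a) {z : ℂ}
    (hz : 0 ≤ z.re) : ‖lockTransform μ a z‖ ≤ 1 / a := by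
  have := norm_integral_le_of_norm_le_const (μ := μ) (f := fun ω : ℝ => lockKernel a (z + I * ω))
    (C := 1 / a) (Eventually.of_forall fun ω => norm_lockKernel_le ha (by simpa using hz))
  simpa [lockTransform] using this

/-- The transform is jointly continuous on the closed half-plane, away from the imaginary axis at
`a = 0`, where the kernel is singular. -/
lemma continuousWithinAt_lockTransform [IsProbabilityMeasure μ] {a : ℝ} {z : ℂ} (hz : 0 ≤ z.re)
    (h : 0 < a ∨ 0 < z.re) :
    ContinuousWithinAt (fun p : ℝ × ℂ => lockTransform μ p.1 p.2) {p | 0 ≤ p.2.re} (a, z) := by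
  -- near `(a, z)` the kernel is bounded by a constant, which dominates for a probability measure
  have key : ∃ C : ℝ, ∀ᶠ p : ℝ × ℂ in 𝓝[{p | 0 ≤ p.2.re}] (a, z),
      (0 < p.1 ∨ 0 < p.2.re) ∧ ∀ ω : ℝ, ‖lockKernel p.1 (p.2 + I * ω)‖ ≤ C := by
    rcases h with h | h
    · refine ⟨1 / (a / 2), ?_⟩
      have h1 : ∀ᶠ p : ℝ × ℂ in 𝓝 (a, z), a / 2 < p.1 :=
        (continuous_fst.tendsto (a, z)).eventually (lt_mem_nhds (by simpa using h))
      filter_upwards [nhdsWithin_le_nhds h1, self_mem_nhdsWithin] with p hp hp2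
      have hp3 : 0 < p.1 := by linarith
      refine ⟨Or.inl hp3, fun ω => (norm_lockKernel_le hp3 (by simpa using hp2)).trans ?_⟩
      exact one_div_le_one_div_of_le (by linarith) hp.le
    · refine ⟨1 / (z.re / 2), ?_⟩
      have h1 : ∀ᶠ p : ℝ × ℂ in 𝓝 (a, z), z.re / 2 < p.2.re :=
        ((continuous_re.comp continuous_snd).tendsto (a, z)).eventually
          (lt_mem_nhds (by simpa using h))
      filter_upwards [nhdsWithin_le_nhds h1] with p hp
      exact ⟨Or.inr (by linarith), fun ω =>
        norm_lockKernel_le_of_le_re _ (by linarith) (by simpa using hp.le)⟩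
  obtain ⟨C, hC⟩ := key
  refine tendsto_integral_filter_of_dominated_convergence (fun _ => C) ?_ ?_
    (integrable_const C) ?_
  · filter_upwards [hC, self_mem_nhdsWithin] with p hp hp2
    exact (continuous_lockKernel_line hp2 hp.1).aestronglyMeasurable
  · filter_upwards [hC] with p hp
    exact Eventually.of_forall hp.2
  · refine Eventually.of_forall fun ω => ?_
    have h1 := continuousAt_lockKernel (a := a) (ζ := z + I * ω) (by simpa using hz)
      (by simpa using h)
    have h2 : ContinuousAt (fun p : ℝ × ℂ => lockKernel p.1 (p.2 + I * ω)) (a, z) :=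
      ContinuousAt.comp (f := fun p : ℝ × ℂ => ((p.1, p.2 + I * ω) : ℝ × ℂ))
        (x := (a, z)) h1 (by fun_prop)
    exact h2.tendsto.mono_left nhdsWithin_le_nhds

lemma differentiableOn_lockTransform [IsProbabilityMeasure μ] (a : ℝ) :
    DifferentiableOn ℂ (lockTransform μ a) {z | 0 < z.re} := by
  intro z hz
  have hz : 0 < z.re := hz
  have hs : {w : ℂ | z.re / 2 < w.re} ∈ 𝓝 z :=
    (continuous_re.tendsto z).eventually (lt_mem_nhds (by simpa using hz))
  refine DifferentiableAt.differentiableWithinAt ?_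
  refine (hasDerivAt_integral_of_dominated_loc_of_deriv_le (μ := μ)
    (F := fun w (ω : ℝ) => lockKernel a (w + I * ω))
    (F' := fun w (ω : ℝ) => deriv (lockKernel a) (w + I * ω))
    (bound := fun _ => 1 / (z.re / 2) * (1 / (z.re / 2))) hs ?_ ?_ ?_ ?_
    (integrable_const _) ?_).2.differentiableAt
  · filter_upwards [hs] with w hw
    have hw : z.re / 2 < w.re := hw
    exact (continuous_lockKernel_line (by linarith) (Or.inr (by linarith))).aestronglyMeasurable
  · exact Integrable.of_bound (C := 1 / z.re)
      (continuous_lockKernel_line hz.le (Or.inr hz)).aestronglyMeasurable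
      (Eventually.of_forall fun ω => norm_lockKernel_le_of_le_re _ hz (by simp))
  · exact ((measurable_deriv _).comp (by fun_prop)).aestronglyMeasurable
  · refine Eventually.of_forall fun ω w hw => ?_
    have hw : z.re / 2 < w.re := hw
    rw [(hasDerivAt_lockKernel a (ζ := w + I * ω) (by simp; linarith)).deriv]
    exact norm_deriv_lockKernel_le a (by linarith) (by simpa using hw.le)
  · refine Eventually.of_forall fun ω w hw => ?_
    have hw : z.re / 2 < w.re := hw
    have h1 := (hasDerivAt_lockKernel a (ζ := w + I * ω) (by simp; linarith))
    exact h1.differentiableAt.hasDerivAt.comp_add_const w _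

/-- Uniformly in `a` away from `0`, the transform vanishes at infinity. -/
lemma exists_forall_norm_lockTransform_lt [IsProbabilityMeasure μ] {a₀ ε : ℝ} (ha₀ : 0 < a₀)
    (hε : 0 < ε) :
    ∃ R : ℝ, ∀ a, a₀ ≤ a → ∀ z : ℂ, 0 ≤ z.re → R ≤ ‖z‖ → ‖lockTransform μ a z‖ < ε := by
  set S : Set (ℝ × ℂ) := {p | a₀ ≤ p.1 ∧ 0 ≤ p.2.re} with hS
  set l : Filter (ℝ × ℂ) := comap (fun p => ‖p.2‖) atTop ⊓ 𝓟 S with hl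
  have hmem : ∀ᶠ p in l, p ∈ S := mem_inf_of_right (mem_principal_self S)
  have hnorm : Tendsto (fun p : ℝ × ℂ => ‖p.2‖) l atTop := tendsto_comap.mono_left inf_le_left
  have h : Tendsto (fun p : ℝ × ℂ => lockTransform μ p.1 p.2) l (𝓝 (∫ _ : ℝ, (0 : ℂ) ∂μ)) := by
    refine tendsto_integral_filter_of_dominated_convergence (fun _ => 1 / a₀) ?_ ?_
      (integrable_const _) ?_
    · filter_upwards [hmem] with p hp
      exact (continuous_lockKernel_line hp.2 (Or.inl (ha₀.trans_le hp.1))).aestronglyMeasurable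
    · filter_upwards [hmem] with p hp
      refine Eventually.of_forall fun ω => ?_
      exact (norm_lockKernel_le (ha₀.trans_le hp.1) (by simpa using hp.2)).trans
        (one_div_le_one_div_of_le ha₀ hp.1)
    · refine Eventually.of_forall fun ω => ?_
      have h1 : Tendsto (fun p : ℝ × ℂ => ‖p.2‖ - |ω|) l atTop :=
        tendsto_atTop_add_const_right _ _ hnorm
      refine squeeze_zero_norm' ?_ (h1.inv_tendsto_atTop)
      filter_upwards [hmem, h1.eventually_gt_atTop 0] with p hp hp2
      have h3 : ‖p.2‖ - |ω| ≤ ‖p.2 + I * ω‖ := by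
        have := norm_sub_le_norm_add p.2 (I * ω)
        simpa using this
      have h4 : p.2 + I * ω ≠ 0 := norm_pos_iff.1 (hp2.trans_le h3)
      refine (norm_lockKernel_le' p.1 (by simpa using hp.2) h4).trans ?_
      rw [Pi.inv_apply, ← one_div]
      exact one_div_le_one_div_of_le hp2 h3
  rw [integral_zero] at h
  have h2 := (h.norm).eventually (gt_mem_nhds (by simpa using hε))
  obtain ⟨R, hR⟩ : ∃ R : ℝ, ∀ p ∈ S, R ≤ ‖p.2‖ → ‖lockTransform μ p.1 p.2‖ < ε := by
    rw [hl, eventually_inf_principal, eventually_comap] at h2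
    obtain ⟨R, hR⟩ := eventually_atTop.1 h2
    exact ⟨R, fun p hp hp2 => hR _ hp2 p rfl hp⟩
  exact ⟨R, fun a ha z hz hzR => hR (a, z) ⟨ha, hz⟩ hzR⟩

lemma isOpen_re_pos : IsOpen {z : ℂ | 0 < z.re} := isOpen_lt continuous_const continuous_re

/-- The transform tends to `0` along the positive reals, hence it is not constant near a point
where it does not vanish. -/
lemma frequently_lockTransform_ne [IsProbabilityMeasure μ] (a : ℝ) {z₀ : ℂ} (hz₀ : 0 < z₀.re)
    (h0 : lockTransform μ a z₀ ≠ 0) :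
    ∃ᶠ z in 𝓝 z₀, lockTransform μ a z ≠ lockTransform μ a z₀ := by
  intro hcon
  simp only [not_not] at hcon
  have h1 : EqOn (lockTransform μ a) (fun _ => lockTransform μ a z₀) {z | 0 < z.re} :=
    AnalyticOnNhd.eqOn_of_preconnected_of_eventuallyEq
      ((differentiableOn_lockTransform a).analyticOnNhd isOpen_re_pos) analyticOnNhd_const
      (convex_halfSpace_re_gt 0).isPreconnected hz₀ hcon
  have hpos : 0 < ‖lockTransform μ a z₀‖ := norm_pos_iff.2 h0
  -- at the positive real `x` the transform is at most `1 / x`, half of the supposed constant norm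
  set x : ℝ := 2 / ‖lockTransform μ a z₀‖ with hx
  have hx0 : 0 < x := by positivity
  have h2 := h1 (show (x : ℂ) ∈ {z : ℂ | 0 < z.re} by simpa using hx0)
  have h3 : ‖lockTransform μ a x‖ ≤ 1 / x := by
    have := norm_integral_le_of_norm_le_const (μ := μ)
      (f := fun ω : ℝ => lockKernel a ((x : ℂ) + I * ω)) (C := 1 / x)
      (Eventually.of_forall fun ω => norm_lockKernel_le_of_le_re a hx0 (by simp))
    simpa [lockTransform] using this
  rw [h2, hx, one_div_div] at h3
  linarith

/-- Solutions of `lockTransform μ a z = w` in the open half-plane persist when `a` is perturbed: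
this is Hurwitz's theorem for the family of holomorphic functions `lockTransform μ a`. -/
lemma eventually_exists_lockTransform_eq [IsProbabilityMeasure μ] {a₀ : ℝ} {z₀ w : ℂ}
    (hz₀ : 0 < z₀.re) (hw : w ≠ 0) (h : lockTransform μ a₀ z₀ = w) :
    ∀ᶠ a in 𝓝 a₀, ∃ z : ℂ, 0 < z.re ∧ lockTransform μ a z = w := by
  have hcont : ∀ a (z : ℂ), 0 < z.re →
      ContinuousAt (fun p : ℝ × ℂ => lockTransform μ p.1 p.2) (a, z) := fun a z hz =>
    (continuousWithinAt_lockTransform hz.le (Or.inr hz)).continuousAt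
      (mem_of_superset ((isOpen_re_pos.preimage continuous_snd).mem_nhds hz)
        fun p hp => (show 0 < p.2.re from hp).le)
  have han : AnalyticAt ℂ (lockTransform μ a₀) z₀ :=
    (differentiableOn_lockTransform a₀).analyticAt (isOpen_re_pos.mem_nhds hz₀)
  have hne : ∀ᶠ z in 𝓝[≠] z₀, lockTransform μ a₀ z ≠ w := by
    rcases han.eventually_eq_or_eventually_ne (analyticAt_const (v := w)) with h1 | h1
    · refine absurd (frequently_lockTransform_ne a₀ hz₀ (h ▸ hw)) ?_
      rw [not_frequently]
      filter_upwards [h1] with z hz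
      simp [hz, h]
    · exact h1
  obtain ⟨ρ, hρ, hball⟩ : ∃ ρ > 0, ∀ z ∈ Metric.closedBall z₀ ρ,
      0 < z.re ∧ (z ≠ z₀ → lockTransform μ a₀ z ≠ w) := by
    have h2 : ∀ᶠ z in 𝓝 z₀, 0 < z.re ∧ (z ≠ z₀ → lockTransform μ a₀ z ≠ w) :=
      (isOpen_re_pos.eventually_mem hz₀).and (eventually_nhdsWithin_iff.1 hne)
    obtain ⟨ρ, hρ, hb⟩ := Metric.nhds_basis_closedBall.eventually_iff.1 h2
    exact ⟨ρ, hρ, fun z hz => hb hz⟩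
  have hsub : Metric.closedBall z₀ ρ ⊆ {z | 0 < z.re} := fun z hz => (hball z hz).1
  have hsph : Metric.sphere z₀ ρ ⊆ Metric.closedBall z₀ ρ := Metric.sphere_subset_closedBall
  -- the least distance to `w` of the values of the unperturbed function on a small circle
  obtain ⟨m, hm, hmin⟩ : ∃ m > 0, ∀ z ∈ Metric.sphere z₀ ρ, m < ‖lockTransform μ a₀ z - w‖ := by
    have hc : ContinuousOn (fun z => ‖lockTransform μ a₀ z - w‖) (Metric.sphere z₀ ρ) :=
      (((differentiableOn_lockTransform a₀).continuousOn.mono (hsph.trans hsub)).sub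
        continuousOn_const).norm
    obtain ⟨x, hx, hxm⟩ := (isCompact_sphere z₀ ρ).exists_isMinOn
      (NormedSpace.sphere_nonempty.2 hρ.le) hc
    have hx0 : 0 < ‖lockTransform μ a₀ x - w‖ :=
      norm_pos_iff.2 (sub_ne_zero.2 ((hball x (hsph hx)).2 (Metric.ne_of_mem_sphere hx hρ.ne')))
    exact ⟨_, half_pos hx0, fun z hz => (half_lt_self hx0).trans_le (hxm hz)⟩
  have hE1 : ∀ᶠ a in 𝓝 a₀, ∀ z ∈ Metric.sphere z₀ ρ, m < ‖lockTransform μ a z - w‖ := by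
    refine (isCompact_sphere z₀ ρ).eventually_forall_of_forall_eventually fun z hz => ?_
    have h3 : ContinuousAt (fun p : ℝ × ℂ => ‖lockTransform μ p.1 p.2 - w‖) (a₀, z) :=
      ((hcont a₀ z (hsub (hsph hz))).sub continuousAt_const).norm
    exact h3.eventually (lt_mem_nhds (hmin z hz))
  have hE2 : ∀ᶠ a in 𝓝 a₀, ‖lockTransform μ a z₀ - w‖ < min (m / 3) ‖w‖ := by
    have h3 : ContinuousAt (fun a : ℝ => lockTransform μ a z₀) a₀ :=
      ContinuousAt.comp (f := fun a : ℝ => (a, z₀)) (hcont a₀ z₀ hz₀) (by fun_prop)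
    refine ((h3.sub continuousAt_const).norm).eventually (gt_mem_nhds ?_)
    simp only [Pi.sub_apply, h, sub_self, norm_zero]
    exact lt_min (by linarith) (norm_pos_iff.2 hw)
  filter_upwards [hE1, hE2] with a ha1 ha2
  have h4 : DiffContOnCl ℂ (lockTransform μ a) (Metric.ball z₀ ρ) :=
    ((differentiableOn_lockTransform a).mono
      ((closure_ball z₀ hρ.ne').symm ▸ hsub)).diffContOnCl
  have hv0 : lockTransform μ a z₀ ≠ 0 := fun h0 => by
    rw [h0, zero_sub, norm_neg] at ha2
    exact absurd (ha2.trans_le (min_le_right _ _)) (lt_irrefl _)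
  have h5 := h4.ball_subset_image_closedBall (ε := 2 * m / 3) hρ (fun z hz => ?_)
    (frequently_lockTransform_ne a hz₀ hv0)
  · obtain ⟨z, hz, hzw⟩ := h5 (show w ∈ _ by
      rw [mem_ball_iff_norm, norm_sub_rev]
      have := ha2.trans_le (min_le_left _ _)
      linarith)
    exact ⟨z, hsub hz, hzw⟩
  · have h6 := ha1 z hz
    have h7 := ha2.trans_le (min_le_left _ _)
    have h8 := norm_sub_le_norm_sub_add_norm_sub (lockTransform μ a z) (lockTransform μ a z₀) w
    linarith

/-- If `lockTransform μ 0 z = 1 / K` has a solution in the open right half-plane, then for some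
`a > 0` the equation `lockTransform μ a z = 1 / K` has a solution on the imaginary axis. The value
of `a` is the supremum of those for which there is a solution in the open half-plane. -/
theorem exists_lockTransform_eq_on_boundary [IsProbabilityMeasure μ] {K : ℝ} (hK : 0 < K) {z₀ : ℂ}
    (hz₀ : 0 < z₀.re) (h : lockTransform μ 0 z₀ = ((1 / K : ℝ) : ℂ)) :
    ∃ a Ω : ℝ, 0 < a ∧ lockTransform μ a (-(I * Ω)) = ((1 / K : ℝ) : ℂ) := by
  set w : ℂ := ((1 / K : ℝ) : ℂ) with hw
  have hw0 : w ≠ 0 := by rw [hw]; exact_mod_cast (one_div_pos.2 hK).ne'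
  have hwn : ‖w‖ = 1 / K := by
    rw [hw, norm_real, Real.norm_eq_abs, abs_of_pos (one_div_pos.2 hK)]
  set A : Set ℝ := {a | 0 ≤ a ∧ ∃ z : ℂ, 0 < z.re ∧ lockTransform μ a z = w} with hA
  have hA0 : (0 : ℝ) ∈ A := ⟨le_rfl, z₀, hz₀, h⟩
  have hbdd : BddAbove A := by
    refine ⟨K, ?_⟩
    rintro a ⟨ha, z, hz, hzw⟩
    rcases ha.eq_or_lt with rfl | ha
    · exact hK.le
    · have := norm_lockTransform_le (μ := μ) ha hz.le
      rw [hzw, hwn] at this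
      exact (one_div_le_one_div hK ha).1 this
  have hopen : ∀ a ∈ A, ∃ b ∈ A, a < b := by
    rintro a ⟨ha, z, hz, hzw⟩
    have h1 := eventually_exists_lockTransform_eq hz hw0 hzw
    have h2 : ∀ᶠ b in 𝓝[>] a, a < b := self_mem_nhdsWithin
    obtain ⟨b, hb1, hb2⟩ := ((h1.filter_mono nhdsWithin_le_nhds).and h2).exists
    exact ⟨b, ⟨ha.trans hb2.le, hb1⟩, hb2⟩
  set s := sSup A with hs
  have hspos : 0 < s := by
    obtain ⟨b, hb, hb0⟩ := hopen 0 hA0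
    exact hb0.trans_le (le_csSup hbdd hb)
  obtain ⟨u, -, hu, huA⟩ := exists_seq_tendsto_sSup ⟨0, hA0⟩ hbdd
  choose hu0 z hz hzw using huA
  obtain ⟨R, hR⟩ := exists_forall_norm_lockTransform_lt (μ := μ) (half_pos hspos)
    (one_div_pos.2 hK)
  have hev : ∀ᶠ n in atTop, z n ∈ Metric.closedBall (0 : ℂ) R := by
    filter_upwards [hu.eventually (lt_mem_nhds (half_lt_self hspos))] with n hn
    rw [mem_closedBall_zero_iff]
    by_contra! hcon
    have := hR (u n) hn.le (z n) (hz n).le hcon.le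
    rw [hzw, hwn] at this
    exact lt_irrefl _ this
  obtain ⟨z', -, φ, hφ, hlim⟩ :=
    (isCompact_closedBall (0 : ℂ) R).tendsto_subseq' hev.frequently
  have hre : 0 ≤ z'.re :=
    ge_of_tendsto' ((continuous_re.tendsto z').comp hlim) fun n => (hz _).le
  have heq : lockTransform μ s z' = w := by
    have h1 : Tendsto (fun n => (u (φ n), z (φ n))) atTop (𝓝[{p | 0 ≤ p.2.re}] (s, z')) :=
      tendsto_nhdsWithin_iff.2 ⟨(hu.comp hφ.tendsto_atTop).prodMk_nhds hlim,
        Eventually.of_forall fun n => (hz (φ n)).le⟩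
    have h2 := (continuousWithinAt_lockTransform (μ := μ) hre (Or.inl hspos)).tendsto.comp h1
    refine tendsto_nhds_unique h2 (tendsto_const_nhds.congr fun n => ?_)
    exact (hzw (φ n)).symm
  have hre0 : z'.re = 0 := by
    by_contra hne
    obtain ⟨b, hb, hsb⟩ := hopen s ⟨hspos.le, z', lt_of_le_of_ne hre (Ne.symm hne), heq⟩
    exact absurd (le_csSup hbdd hb) (not_le.2 hsb)
  refine ⟨s, -z'.im, hspos, ?_⟩
  convert heq using 2
  apply Complex.ext <;> simp [hre0]

/-! ### Boundary values and the Laplace transform of the Fourier transform -/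

/-- The kernel is a root of `a² X² + 2ζ X = 1`. Together with `0 ≤ Re X` and `|X| ≤ 1 / a` this
identifies its boundary values without any discussion of branches. -/
lemma lockKernel_quadratic (a : ℝ) {ζ : ℂ} (hζ : 0 ≤ ζ.re) (h : 0 < a ∨ 0 < ζ.re) :
    a ^ 2 * lockKernel a ζ ^ 2 + 2 * ζ * lockKernel a ζ = 1 := by
  have hs := sqrtSum_ne_zero hζ h
  have h1 := cpow_half_sq (ζ - a * I)
  have h2 := cpow_half_sq (ζ + a * I)
  unfold lockKernel
  unfold sqrtSum at hs ⊢
  generalize (ζ - a * I) ^ (2⁻¹ : ℂ) = p at *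
  generalize (ζ + a * I) ^ (2⁻¹ : ℂ) = q at *
  have e1 : (p + q) ^ 2 = 2 * ζ + 2 * (p * q) := by linear_combination h1 + h2
  have e2 : (p * q) ^ 2 = ζ ^ 2 + a ^ 2 := by
    linear_combination q ^ 2 * h1 + (ζ - a * I) * h2 - a ^ 2 * I_sq
  field_simp
  have e3 : (p + q) ^ 4 = (2 * ζ + 2 * (p * q)) ^ 2 := by rw [← e1]; ring
  linear_combination 4 * ζ * e1 - e3 - 4 * e2

lemma lockKernel_re_nonneg (a : ℝ) {ζ : ℂ} (hζ : 0 ≤ ζ.re) : 0 ≤ (lockKernel a ζ).re := by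
  have h1 := abs_im_cpow_half_le (x := ζ - a * I) (by simpa using hζ)
  have h2 := abs_im_cpow_half_le (x := ζ + a * I) (by simpa using hζ)
  have h3 : 0 ≤ (sqrtSum a ζ ^ 2).re := by
    have h4 : |(sqrtSum a ζ).im| ≤ (sqrtSum a ζ).re := by
      simp only [sqrtSum, add_re, add_im]
      exact (abs_add_le _ _).trans (add_le_add h1 h2)
    have h5 := sq_le_sq' (neg_le_of_abs_le h4) (le_of_abs_le h4)
    rw [pow_two, mul_re]
    linarith
  rw [lockKernel, div_re]
  simp only [re_ofNat, im_ofNat, zero_mul, zero_div, add_zero]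
  exact div_nonneg (mul_nonneg zero_le_two h3) (normSq_nonneg _)

/-- The mean of `e^{iθ}` for the oscillators of relative frequency `x` under the profile `f_s` with
parameter `a`, see `integral_expT_phaseKernel`. It is defined by the boundary values of the
kernel. -/
def meanPhase (a x : ℝ) : ℂ := a * (starRingEnd ℂ) (lockKernel a (I * x))

lemma meanPhase_quadratic {a : ℝ} (ha : 0 < a) (x : ℝ) :
    a * meanPhase a x ^ 2 - 2 * I * x * meanPhase a x = a := by
  have h := lockKernel_quadratic a (ζ := I * x) (by simp) (Or.inl ha)
  have h2 := congrArg (starRingEnd ℂ) h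
  simp only [map_add, map_mul, map_pow, conj_ofReal, conj_I, map_ofNat, map_one] at h2
  rw [meanPhase]
  linear_combination (a : ℂ) * h2

lemma meanPhase_re_nonneg {a : ℝ} (ha : 0 < a) (x : ℝ) : 0 ≤ (meanPhase a x).re := by
  rw [meanPhase, re_ofReal_mul, conj_re]
  exact mul_nonneg ha.le (lockKernel_re_nonneg a (by simp))

lemma norm_meanPhase_le {a : ℝ} (ha : 0 < a) (x : ℝ) : ‖meanPhase a x‖ ≤ 1 := by
  rw [meanPhase, norm_mul, RCLike.norm_conj, norm_real, Real.norm_eq_abs, abs_of_pos ha]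
  have := norm_lockKernel_le ha (ζ := I * x) (by simp)
  rwa [le_div_iff₀ ha, mul_comm] at this

/-- Real and imaginary part of the quadratic equation, and the bound on the modulus. -/
lemma meanPhase_re_im {a : ℝ} (ha : 0 < a) (x : ℝ) :
    a * ((meanPhase a x).re ^ 2 - (meanPhase a x).im ^ 2) + 2 * x * (meanPhase a x).im = a ∧
    (meanPhase a x).re * (a * (meanPhase a x).im - x) = 0 ∧
    (meanPhase a x).re ^ 2 + (meanPhase a x).im ^ 2 ≤ 1 := by
  have h := meanPhase_quadratic ha x
  have hn := norm_meanPhase_le ha x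
  have hn2 : normSq (meanPhase a x) ≤ 1 := by
    rw [normSq_eq_norm_sq]; exact pow_le_one₀ (norm_nonneg _) hn
  rw [normSq_apply] at hn2
  have h1 := congrArg re h
  have h2 := congrArg im h
  simp [pow_two] at h1 h2
  refine ⟨by linarith, by linarith, by linarith⟩

/-- For a locked oscillator the mean phase factor is `e^{iθ}` with `θ = arcsin (x / a)`. -/
lemma meanPhase_of_abs_le {a x : ℝ} (ha : 0 < a) (hx : |x| ≤ a) :
    meanPhase a x = Real.sqrt (1 - (x / a) ^ 2) + (x / a : ℝ) * I := by
  obtain ⟨h1, h2, h3⟩ := meanPhase_re_im ha x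
  have h0 := meanPhase_re_nonneg ha x
  set u := (meanPhase a x).re with hu
  set v := (meanPhase a x).im with hv
  have hva : a * v = x := by
    rcases mul_eq_zero.1 h2 with h | h
    · have hx2 : x ^ 2 ≤ a ^ 2 := sq_le_sq' (neg_le_of_abs_le hx) (le_of_abs_le hx)
      rw [h] at h1
      have : (a * v - x) ^ 2 = x ^ 2 - a ^ 2 := by linear_combination (-a) * h1
      have : (a * v - x) ^ 2 ≤ 0 := by linarith
      have := pow_eq_zero_iff (two_ne_zero) |>.1 (le_antisymm this (sq_nonneg _))
      linarith
    · linarith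
  have hv' : v = x / a := by rw [← hva]; field_simp
  have hu2 : u ^ 2 = 1 - v ^ 2 := by
    have : a * (u ^ 2 - (1 - v ^ 2)) = 0 := by rw [← hva] at h1; linarith
    rcases mul_eq_zero.1 this with h | h
    · exact absurd h ha.ne'
    · linarith
  rw [← hv', ← hu2, Real.sqrt_sq h0, hu, hv, re_add_im]

/-- For a drifting oscillator the mean phase factor is purely imaginary, of modulus less than `1`;
the equation for `c` says `(1 + c²) / (2c) = x / a`. -/
lemma meanPhase_of_lt_abs {a x : ℝ} (ha : 0 < a) (hx : a < |x|) :
    ∃ c : ℝ, |c| < 1 ∧ a * (1 + c ^ 2) = 2 * x * c ∧ meanPhase a x = c * I := by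
  obtain ⟨h1, h2, h3⟩ := meanPhase_re_im ha x
  set u := (meanPhase a x).re with hu
  set v := (meanPhase a x).im with hv
  have hx2 : a ^ 2 < x ^ 2 := by
    rw [← sq_abs x]; exact pow_lt_pow_left₀ hx ha.le two_ne_zero
  have hu0 : u = 0 := by
    rcases mul_eq_zero.1 h2 with h | h
    · exact h
    · exfalso
      have : x = a * v := by linarith
      rw [this] at hx2
      nlinarith [sq_nonneg u, pow_pos ha 2]
  rw [hu0] at h1 h3
  have heq : a * (1 + v ^ 2) = 2 * x * v := by linarith
  refine ⟨v, ?_, heq, ?_⟩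
  · rw [← sq_lt_one_iff_abs_lt_one]
    refine lt_of_le_of_ne (by linarith) fun h => ?_
    have e := congrArg (· ^ 2) heq
    simp only [mul_pow, h] at e
    nlinarith
  · apply Complex.ext
    · simp [← hu, hu0]
    · simp [← hv]

lemma isProbabilityMeasure_densityMeasure {g : ℝ → ℝ} (hg_nonneg : ∀ ω, 0 ≤ g ω)
    (hg_int : Integrable g) (hg_one : ∫ ω, g ω = 1) :
    IsProbabilityMeasure (densityMeasure g) := by
  refine ⟨?_⟩
  rw [densityMeasure, withDensity_apply _ MeasurableSet.univ, Measure.restrict_univ,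
    ← ofReal_integral_eq_lintegral_ofReal hg_int (Eventually.of_forall hg_nonneg), hg_one,
    ENNReal.ofReal_one]

lemma integral_densityMeasure {g : ℝ → ℝ} (hg_nonneg : ∀ ω, 0 ≤ g ω) (hg : Measurable g)
    (f : ℝ → ℂ) : ∫ ω, f ω ∂(densityMeasure g) = ∫ ω, (g ω : ℂ) * f ω := by
  rw [densityMeasure, integral_withDensity_eq_integral_toReal_smul
    hg.ennreal_ofReal (Eventually.of_forall fun _ => ENNReal.ofReal_lt_top)]
  refine integral_congr_ae (Eventually.of_forall fun ω => ?_)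
  simp [ENNReal.toReal_ofReal (hg_nonneg ω)]

/-- The Laplace transform of the Fourier transform of `g` is the Cauchy transform
`∫ g(ω) / (z + iω) dω`. -/
lemma integral_fourier_mul_exp {g : ℝ → ℝ} (hg_nonneg : ∀ ω, 0 ≤ g ω) (hg : Measurable g)
    (hg_int : Integrable g) {z : ℂ} (hz : 0 < z.re) :
    ∫ τ in Ioi (0 : ℝ), fourier g τ * Complex.exp (-(z * τ)) =
      2 * lockTransform (densityMeasure g) 0 z := by
  have hint : Integrable (fun p : ℝ × ℝ => (g p.2 : ℂ) * Complex.exp (-(I * p.1 * p.2)) *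
      Complex.exp (-(z * p.1))) ((volume.restrict (Ioi 0)).prod volume) := by
    have h1 : IntegrableOn (fun τ : ℝ => Complex.exp (-z * τ)) (Ioi 0) :=
      integrableOn_exp_mul_complex_Ioi (by simpa using hz) 0
    have h2 := Integrable.mul_prod h1 (hg_int.ofReal (𝕜 := ℂ))
    refine h2.mono ?_ (Eventually.of_forall fun p => ?_)
    · exact Measurable.aestronglyMeasurable (by fun_prop)
    · rw [norm_mul, norm_mul, norm_mul]
      have : ‖Complex.exp (-(I * p.1 * p.2))‖ = 1 := by
        rw [norm_exp]; simp
      rw [this, mul_one, mul_comm]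
      simp
  have hswap := integral_integral_swap (f := fun (τ ω : ℝ) => (g ω : ℂ) *
    Complex.exp (-(I * τ * ω)) * Complex.exp (-(z * τ))) hint
  have hl : ∀ τ : ℝ, fourier g τ * Complex.exp (-(z * τ)) =
      ∫ ω : ℝ, (g ω : ℂ) * Complex.exp (-(I * τ * ω)) * Complex.exp (-(z * τ)) := fun τ => by
    rw [integral_mul_const]; rfl
  simp_rw [hl]
  rw [hswap, lockTransform, integral_densityMeasure hg_nonneg hg, ← integral_const_mul]
  refine integral_congr_ae (Eventually.of_forall fun ω => ?_)
  have hre : 0 < (z + I * ω).re := by simpa using hz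
  have hne : z + I * ω ≠ 0 := fun h => by simp [h] at hre
  have h3 : ∀ τ : ℝ, (g ω : ℂ) * Complex.exp (-(I * τ * ω)) * Complex.exp (-(z * τ)) =
      g ω * Complex.exp (-(z + I * ω) * τ) := fun τ => by
    rw [mul_assoc, ← Complex.exp_add]
    congr 2
    ring
  simp only [h3]
  rw [integral_const_mul, integral_exp_mul_complex_Ioi (by rw [neg_re]; linarith),
    lockKernel_zero]
  simp only [ofReal_zero, mul_zero, Complex.exp_zero]
  field_simp

/-! ### The conditional law of the phase -/

lemma continuous_sinT : Continuous sinT := Real.Angle.continuous_sin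

lemma expT_eq (θ : T1) : expT θ = Real.Angle.cos θ + sinT θ * I := Real.Angle.coe_toCircle θ

lemma continuous_expT : Continuous expT := by
  have h : expT = fun θ : T1 => (Real.Angle.cos θ : ℂ) + sinT θ * I := funext expT_eq
  have hc : Continuous (fun θ : T1 => Real.Angle.cos θ) := Real.Angle.continuous_cos
  rw [h]
  exact (continuous_ofReal.comp hc).add ((continuous_ofReal.comp continuous_sinT).mul
    continuous_const)

lemma norm_expT (θ : T1) : ‖expT θ‖ = 1 := Circle.norm_coe _

lemma expT_add (θ η : T1) : expT (θ + η) = expT θ * expT η := by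
  have : Real.Angle.toCircle (θ + η) = Real.Angle.toCircle θ * Real.Angle.toCircle η :=
    Real.Angle.toCircle_add θ η
  rw [expT, this]
  rfl

lemma expT_im (θ : T1) : (expT θ).im = sinT θ := by simp [expT_eq]

lemma abs_sinT_le (θ : T1) : |sinT θ| ≤ 1 := by
  rw [← expT_im, ← norm_expT θ]
  exact abs_im_le_norm _

lemma sinT_neg (θ : T1) : sinT (-θ) = -sinT θ := Real.Angle.sin_neg θ

lemma sinT_coe (t : ℝ) : sinT (t : T1) = Real.sin t := Real.Angle.sin_coe t

lemma expT_coe (t : ℝ) : expT (t : T1) = circleMap 0 1 t := by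
  have : expT (t : T1) = Circle.exp t := rfl
  simp [this, circleMap]

/-- The conditional density `√(x² - a²) / (2π |x - a sin θ|)` of the phase of a drifting oscillator
of relative frequency `x`. -/
def driftDensity (a x : ℝ) (θ : T1) : ℝ :=
  Real.sqrt (x ^ 2 - a ^ 2) / (2 * Real.pi * |x - a * sinT θ|)

lemma driftDensity_nonneg (a x : ℝ) (θ : T1) : 0 ≤ driftDensity a x θ :=
  div_nonneg (Real.sqrt_nonneg _) (mul_nonneg Real.two_pi_pos.le (abs_nonneg _))

lemma measurable_driftDensity (a : ℝ) :
    Measurable (fun p : ℝ × T1 => driftDensity a p.1 p.2) := by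
  have := continuous_sinT.measurable
  unfold driftDensity
  fun_prop

lemma abs_mul_sinT_lt {a x : ℝ} (ha : 0 < a) (hx : a < |x|) (θ : T1) : |a * sinT θ| < |x| := by
  rw [abs_mul, abs_of_pos ha]
  nlinarith [abs_sinT_le θ]

lemma sub_mul_sinT_ne_zero {a x : ℝ} (ha : 0 < a) (hx : a < |x|) (θ : T1) :
    x - a * sinT θ ≠ 0 := by
  have := abs_mul_sinT_lt ha hx θ
  intro h
  rw [sub_eq_zero.1 h] at this
  simp at this

lemma continuous_driftDensity {a x : ℝ} (ha : 0 < a) (hx : a < |x|) :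
    Continuous (driftDensity a x) := by
  have := continuous_sinT
  refine continuous_const.div (by fun_prop) fun θ => ?_
  exact mul_ne_zero Real.two_pi_pos.ne' (abs_ne_zero.2 (sub_mul_sinT_ne_zero ha hx θ))

/-- Up to the factor `2π`, the drifting density is the Poisson kernel of the unit disc at the point
`ic` given by `meanPhase_of_lt_abs`. -/
lemma driftDensity_eq_poisson {a x c : ℝ} (ha : 0 < a) (hx : a < |x|) (hc : |c| < 1)
    (h : a * (1 + c ^ 2) = 2 * x * c) (t : ℝ) :
    driftDensity a x (t : T1) = (2 * Real.pi)⁻¹ *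
      ((‖circleMap 0 1 t - 0‖ ^ 2 - ‖(c * I : ℂ) - 0‖ ^ 2) /
        ‖(circleMap 0 1 t - 0) - ((c * I : ℂ) - 0)‖ ^ 2) := by
  have hc0 : c ≠ 0 := by
    rintro rfl
    simp at h
    exact ha.ne' h
  have hc2 : 0 < 1 - c ^ 2 := sub_pos.2 ((sq_lt_one_iff_abs_lt_one c).2 hc)
  have hcpos : 0 < |c| := abs_pos.2 hc0
  have hs := sub_mul_sinT_ne_zero ha hx (t : T1)
  rw [sinT_coe] at hs
  have e1 : ‖circleMap 0 1 t - 0‖ ^ 2 = 1 := by simp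
  have e2 : ‖(c * I : ℂ) - 0‖ ^ 2 = c ^ 2 := by simp
  have e3 : ‖(circleMap 0 1 t - 0) - ((c * I : ℂ) - 0)‖ ^ 2 =
      1 + c ^ 2 - 2 * c * Real.sin t := by
    rw [← normSq_eq_norm_sq, normSq_apply, ← expT_coe]
    have r1 : (expT (t : T1)).re = Real.cos t := by simp [expT_coe, circleMap, exp_re]
    have r2 : (expT (t : T1)).im = Real.sin t := by rw [expT_im, sinT_coe]
    simp [r1, r2]
    nlinarith [Real.sin_sq_add_cos_sq t]
  have e4 : 1 + c ^ 2 - 2 * c * Real.sin t = 2 * |c| * |x - a * Real.sin t| / a := by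
    have h5 : 0 ≤ 1 + c ^ 2 - 2 * c * Real.sin t := e3 ▸ sq_nonneg _
    rw [← abs_of_nonneg h5, eq_div_iff ha.ne', ← abs_of_pos (show (0 : ℝ) < 2 by norm_num),
      ← abs_mul, ← abs_mul]
    conv_lhs => rw [← abs_of_pos ha]
    rw [← abs_mul]
    congr 1
    rw [abs_of_pos (show (0 : ℝ) < 2 by norm_num)]
    linear_combination h
  have e5 : Real.sqrt (x ^ 2 - a ^ 2) = a * (1 - c ^ 2) / (2 * |c|) := by
    rw [Real.sqrt_eq_iff_mul_self_eq_of_pos (by positivity)]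
    field_simp
    rw [sq_abs]
    linear_combination (a * (1 + c ^ 2) + 2 * x * c) * h
  rw [e1, e2, e3, e4, driftDensity, e5, sinT_coe]
  have := abs_pos.2 hs
  field_simp

lemma integral_driftDensity_mul_comp_expT {a x c : ℝ} (ha : 0 < a) (hx : a < |x|) (hc : |c| < 1)
    (h : a * (1 + c ^ 2) = 2 * x * c) {F : ℂ → ℂ} (hF : Differentiable ℂ F) :
    ∫ θ : T1, (driftDensity a x θ : ℂ) * F (expT θ) = F (c * I) := by
  rw [← AddCircle.intervalIntegral_preimage (2 * Real.pi) 0, zero_add]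
  have hw : (c * I : ℂ) ∈ Metric.ball (0 : ℂ) 1 := by simpa using hc
  rw [← hF.diffContOnCl.circleAverage_poissonKernel_smul' hw, Real.circleAverage_def,
    ← intervalIntegral.integral_smul]
  refine intervalIntegral.integral_congr fun t _ => ?_
  simp only [driftDensity_eq_poisson ha hx hc h t, expT_coe, real_smul]
  push_cast
  ring

lemma integral_driftDensity {a x : ℝ} (ha : 0 < a) (hx : a < |x|) :
    ∫ θ : T1, driftDensity a x θ = 1 := by
  obtain ⟨c, hc, h, -⟩ := meanPhase_of_lt_abs ha hx
  have := integral_driftDensity_mul_comp_expT ha hx hc h (F := fun _ => 1) (by fun_prop)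
  simp only [mul_one] at this
  rw [integral_complex_ofReal] at this
  exact_mod_cast this

lemma measurableSet_locked (a : ℝ) : MeasurableSet {x : ℝ | |x| ≤ a} :=
  measurableSet_le (by fun_prop) measurable_const

lemma measurable_lockedPhase (a : ℝ) :
    Measurable (fun x : ℝ => ((Real.arcsin (x / a) : ℝ) : T1)) :=
  ((AddCircle.continuous_mk' _).comp Real.continuous_arcsin).measurable.comp
    (measurable_id.div_const a)

/-- The conditional law under `f_s` of the phase, given the relative frequency `x`: a Dirac mass if
`|x| ≤ a`, the density `driftDensity a x` otherwise. -/
def phaseKernel (a : ℝ) : Kernel ℝ T1 :=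
  open Classical in
  Kernel.piecewise (measurableSet_locked a)
    (Kernel.deterministic (fun x : ℝ => ((Real.arcsin (x / a) : ℝ) : T1))
      (measurable_lockedPhase a))
    (Kernel.withDensity (Kernel.const ℝ (volume : Measure T1))
      (fun x θ => ENNReal.ofReal (driftDensity a x θ)))

lemma measurable_ofReal_driftDensity (a : ℝ) : Measurable
    (Function.uncurry fun (x : ℝ) (θ : T1) => ENNReal.ofReal (driftDensity a x θ)) :=
  (measurable_driftDensity a).ennreal_ofReal

lemma measurable_ofReal_driftDensity_apply (a x : ℝ) :
    Measurable (fun θ : T1 => ENNReal.ofReal (driftDensity a x θ)) :=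
  (measurable_ofReal_driftDensity a).comp measurable_prodMk_left

lemma phaseKernel_of_abs_le {a x : ℝ} (hx : |x| ≤ a) :
    phaseKernel a x = Measure.dirac ((Real.arcsin (x / a) : ℝ) : T1) := by
  rw [phaseKernel, Kernel.piecewise_apply, if_pos (by exact hx), Kernel.deterministic_apply]

lemma phaseKernel_of_lt_abs {a x : ℝ} (hx : a < |x|) :
    phaseKernel a x = volume.withDensity (fun θ => ENNReal.ofReal (driftDensity a x θ)) := by
  rw [phaseKernel, Kernel.piecewise_apply, if_neg (by simpa using hx),
    Kernel.withDensity_apply _ (measurable_ofReal_driftDensity a), Kernel.const_apply]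

lemma isMarkovKernel_phaseKernel {a : ℝ} (ha : 0 < a) : IsMarkovKernel (phaseKernel a) := by
  refine ⟨fun x => ?_⟩
  rcases le_or_gt |x| a with hx | hx
  · rw [phaseKernel_of_abs_le hx]
    infer_instance
  · rw [phaseKernel_of_lt_abs hx]
    refine ⟨?_⟩
    rw [withDensity_apply _ MeasurableSet.univ, Measure.restrict_univ,
      ← ofReal_integral_eq_lintegral_ofReal
        ((continuous_driftDensity ha hx).integrable_of_hasCompactSupport
          (HasCompactSupport.of_compactSpace _))
        (Eventually.of_forall (driftDensity_nonneg a x)),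
      integral_driftDensity ha hx, ENNReal.ofReal_one]

lemma integral_phaseKernel_of_lt_abs {E : Type*} [NormedAddCommGroup E] [NormedSpace ℝ E]
    {a x : ℝ} (hx : a < |x|) (F : T1 → E) :
    ∫ θ, F θ ∂(phaseKernel a x) = ∫ θ, driftDensity a x θ • F θ := by
  rw [phaseKernel_of_lt_abs hx, integral_withDensity_eq_integral_toReal_smul
    (measurable_ofReal_driftDensity_apply a x)
    (Eventually.of_forall fun _ => ENNReal.ofReal_lt_top)]
  simp only [ENNReal.toReal_ofReal (driftDensity_nonneg a x _)]

lemma integral_expT_phaseKernel {a : ℝ} (ha : 0 < a) (x : ℝ) :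
    ∫ θ, expT θ ∂(phaseKernel a x) = meanPhase a x := by
  rcases le_or_gt |x| a with hx | hx
  · rw [phaseKernel_of_abs_le hx, integral_dirac, meanPhase_of_abs_le ha hx, expT_eq, sinT_coe]
    have h1 := abs_le.1 hx
    have hc : Real.Angle.cos ((Real.arcsin (x / a) : ℝ) : T1) = Real.cos (Real.arcsin (x / a)) :=
      Real.Angle.cos_coe _
    rw [hc, Real.cos_arcsin, Real.sin_arcsin]
    · rw [le_div_iff₀ ha]; linarith
    · rw [div_le_iff₀ ha]; linarith
  · obtain ⟨c, hc, h, hm⟩ := meanPhase_of_lt_abs ha hx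
    rw [integral_phaseKernel_of_lt_abs hx, hm]
    simpa using integral_driftDensity_mul_comp_expT ha hx hc h (F := id) differentiable_id

/-- Both parts of the profile together are the measure with frequency density `h` and conditional
phase law `phaseKernel a`. -/
lemma fs_eq_map_compProd {a : ℝ} (ha : 0 < a) {h : ℝ → ℝ} (hh : Measurable h)
    [SFinite (densityMeasure h)] :
    fs a h = ((densityMeasure h) ⊗ₘ (phaseKernel a)).map Prod.swap := by
  have := isMarkovKernel_phaseKernel ha
  refine Measure.ext_of_lintegral _ fun φ hφ => ?_
  have hsin := continuous_sinT.measurable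
  have hA := measurableSet_locked a
  have hD : Measurable (fun p : Cyl => ENNReal.ofReal
      (Real.sqrt (p.2 ^ 2 - a ^ 2) / (2 * Real.pi * |p.2 - a * sinT p.1|) * h p.2)) := by
    fun_prop
  have hB : MeasurableSet {p : Cyl | a < |p.2|} := measurableSet_lt measurable_const (by fun_prop)
  have hpair : Measurable (fun ω : ℝ => (((Real.arcsin (ω / a) : ℝ) : T1), ω)) :=
    (measurable_lockedPhase a).prodMk measurable_id
  have hφx : ∀ x, Measurable (fun θ : T1 => φ (θ, x)) := fun x =>
    hφ.comp measurable_prodMk_right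
  have hinner : Measurable (fun x => ∫⁻ θ, φ (θ, x) ∂(phaseKernel a x)) :=
    Measurable.lintegral_kernel_prod_right' (f := fun p : ℝ × T1 => φ (p.2, p.1))
      (hφ.comp measurable_swap)
  rw [lintegral_map hφ measurable_swap, 
    Measure.lintegral_compProd (f := fun p => φ p.swap) (hφ.comp measurable_swap),
    fs, lintegral_add_measure, lockedPart, driftingPart, lintegral_map hφ hpair,
    lintegral_withDensity_eq_lintegral_mul _ hD hφ, 
    ← lintegral_add_compl (fun x => ∫⁻ θ, φ (x, θ).swap ∂(phaseKernel a x)) hA]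
  congr 1
  · refine setLIntegral_congr_fun hA fun x hx => ?_
    simp only [Prod.swap_prod_mk]
    rw [phaseKernel_of_abs_le hx, lintegral_dirac' _ (hφx x)]
  · simp only [Prod.swap_prod_mk]
    rw [← lintegral_indicator hB, Measure.volume_eq_prod, lintegral_prod_symm _
      ((hD.mul hφ).indicator hB).aemeasurable, ← lintegral_indicator hA.compl,
      densityMeasure, lintegral_withDensity_eq_lintegral_mul _ hh.ennreal_ofReal
        (hinner.indicator hA.compl)]
    refine lintegral_congr fun x => ?_
    rcases le_or_gt |x| a with hx | hx
    · have h1 : x ∉ {x : ℝ | |x| ≤ a}ᶜ := by simpa using hx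
      have h2 : ∀ θ : T1, (θ, x) ∉ {p : Cyl | a < |p.2|} := fun θ => by simpa using hx
      simp only [Pi.mul_apply, indicator_of_notMem h1, indicator_of_notMem (h2 _), mul_zero,
        lintegral_zero]
    · have h1 : x ∈ {x : ℝ | |x| ≤ a}ᶜ := by simpa using hx
      have h2 : ∀ θ : T1, (θ, x) ∈ {p : Cyl | a < |p.2|} := fun θ => by simpa using hx
      simp only [Pi.mul_apply, indicator_of_mem h1, indicator_of_mem (h2 _)]
      rw [phaseKernel_of_lt_abs hx, lintegral_withDensity_eq_lintegral_mul _
        (measurable_ofReal_driftDensity_apply a x)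
        (hφx x), ← lintegral_const_mul]
      · refine lintegral_congr fun θ => ?_
        change ENNReal.ofReal (driftDensity a x θ * h x) * _ = _
        rw [ENNReal.ofReal_mul (driftDensity_nonneg a x θ)]
        simp only [Pi.mul_apply]
        ring
      · exact (measurable_ofReal_driftDensity_apply a x).mul (hφx x)

/-! ### The rotating profile -/

lemma map_densityMeasure_comp_add {g : ℝ → ℝ} (hg : Measurable g) (Ω : ℝ) :
    (densityMeasure (fun ω => g (ω + Ω))).map (fun ω => ω + Ω) = densityMeasure g := by
  refine Measure.ext fun s hs => ?_
  rw [Measure.map_apply (by fun_prop) hs, densityMeasure, densityMeasure,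
    withDensity_apply _ hs, withDensity_apply _ (hs.preimage (by fun_prop))]
  exact (measurePreserving_add_right volume Ω).setLIntegral_comp_preimage hs hg.ennreal_ofReal

lemma measurable_galilean (Θ : T1) (Ω : ℝ) :
    Measurable (fun p : Cyl => (p.1 + Θ, p.2 + Ω)) :=
  (show Continuous (fun p : Cyl => (p.1 + Θ, p.2 + Ω)) by fun_prop).measurable

section profile

variable {a Ω : ℝ} {g : ℝ → ℝ}

lemma isProbabilityMeasure_comp_add (hg_nonneg : ∀ ω, 0 ≤ g ω) (hg_int : Integrable g)
    (hg_one : ∫ ω, g ω = 1) (Ω : ℝ) :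
    IsProbabilityMeasure (densityMeasure (fun ω => g (ω + Ω))) :=
  isProbabilityMeasure_densityMeasure (fun _ => hg_nonneg _) (hg_int.comp_add_right Ω)
    ((integral_add_right_eq_self g Ω).trans hg_one)

lemma rotatingFs_eq_map (ha : 0 < a) (hg : Measurable g)
    [SFinite (densityMeasure (fun ω => g (ω + Ω)))] :
    rotatingFs a Ω g = ((densityMeasure (fun ω => g (ω + Ω))) ⊗ₘ (phaseKernel a)).map
      (fun p => (p.2, p.1 + Ω)) := by
  have hh : Measurable (fun ω => g (ω + Ω)) := by fun_prop
  rw [rotatingFs, galilean, fs_eq_map_compProd ha hh,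
    Measure.map_map (measurable_galilean 0 Ω) measurable_swap]
  congr 1
  ext p <;> simp

lemma isProbabilityMeasure_rotatingFs (ha : 0 < a) (hg : Measurable g)
    [IsProbabilityMeasure (densityMeasure (fun ω => g (ω + Ω)))] :
    IsProbabilityMeasure (rotatingFs a Ω g) := by
  have := isMarkovKernel_phaseKernel ha
  rw [rotatingFs_eq_map ha hg]
  exact Measure.isProbabilityMeasure_map (by fun_prop)

lemma frequencyMarginal_rotatingFs (ha : 0 < a) (hg : Measurable g)
    [SFinite (densityMeasure (fun ω => g (ω + Ω)))] :
    frequencyMarginal (rotatingFs a Ω g) = densityMeasure g := by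
  have := isMarkovKernel_phaseKernel ha
  have h1 := Measure.fst_compProd (densityMeasure (fun ω => g (ω + Ω))) (phaseKernel a)
  have h2 := congrArg (Measure.map fun ω => ω + Ω) h1
  rw [Measure.fst, Measure.map_map (by fun_prop) measurable_fst,
    map_densityMeasure_comp_add hg Ω] at h2
  rw [frequencyMarginal, rotatingFs_eq_map ha hg, Measure.map_map measurable_snd (by fun_prop),
    ← h2]
  rfl

/-- Integrals against the rotating profile, with the relative frequency `x = ω - Ω` as outer
variable. -/
lemma integral_rotatingFs {E : Type*} [NormedAddCommGroup E] [NormedSpace ℝ E]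
    (ha : 0 < a) (hg : Measurable g) [SFinite (densityMeasure (fun ω => g (ω + Ω)))]
    {φ : Cyl → E} (hφ : Integrable φ (rotatingFs a Ω g)) :
    ∫ p, φ p ∂(rotatingFs a Ω g) =
      ∫ x, ∫ θ, φ (θ, x + Ω) ∂(phaseKernel a x) ∂(densityMeasure (fun ω => g (ω + Ω))) := by
  have := isMarkovKernel_phaseKernel ha
  rw [rotatingFs_eq_map ha hg] at hφ ⊢
  have hm : Measurable (fun p : ℝ × T1 => (p.2, p.1 + Ω)) := by fun_prop
  rw [integral_map hm.aemeasurable hφ.aestronglyMeasurable,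
    Measure.integral_compProd (f := fun p : ℝ × T1 => φ (p.2, p.1 + Ω)) (hφ.comp_measurable hm)]

lemma integrable_expT_fst {f : Measure Cyl} [IsFiniteMeasure f] :
    Integrable (fun p : Cyl => expT p.1) f :=
  Integrable.of_bound (C := 1) (continuous_expT.comp continuous_fst).aestronglyMeasurable
    (Eventually.of_forall fun p => (norm_expT p.1).le)

/-- The order parameter of the rotating profile is the conjugate of a boundary value of the
transform. -/
lemma orderParameter_rotatingFs (ha : 0 < a) (hg : Measurable g)
    [IsProbabilityMeasure (densityMeasure (fun ω => g (ω + Ω)))] :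
    orderParameter (rotatingFs a Ω g) =
      a * (starRingEnd ℂ) (lockTransform (densityMeasure g) a (-(I * Ω))) := by
  have := isProbabilityMeasure_rotatingFs (Ω := Ω) ha hg
  rw [orderParameter, integral_rotatingFs ha hg integrable_expT_fst]
  simp only [integral_expT_phaseKernel ha]
  rw [lockTransform, ← integral_conj, ← integral_const_mul, ← map_densityMeasure_comp_add hg Ω,
    (measurableEmbedding_addRight Ω).integral_map]
  refine integral_congr_ae (Eventually.of_forall fun x => ?_)
  simp only [meanPhase]
  congr 3
  push_cast
  ring

end profile

/-! ### Test functions and stationarity -/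

section testFunction

variable {φ : Cyl → ℝ}

lemma hasDerivAt_angle (hφ : IsTestFunction φ) (p : Cyl) (s₀ : ℝ) :
    HasDerivAt (fun s : ℝ => φ (p.1 + (s : T1), p.2))
      (angleDeriv φ (p.1 + (s₀ : T1), p.2)) s₀ := by
  obtain ⟨θ, ω⟩ := p
  obtain ⟨x, rfl⟩ := QuotientAddGroup.mk_surjective θ
  have key : ∀ s₁ : ℝ, DifferentiableAt ℝ (fun s : ℝ => φ ((x : T1) + (s : T1), ω)) s₁ := by
    intro s₁
    have h1 : Differentiable ℝ (fun s : ℝ => φ (((x + s : ℝ) : T1), ω)) :=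
      (hφ.1.differentiable one_ne_zero).comp
        (show Differentiable ℝ (fun s : ℝ => ((x + s, ω) : ℝ × ℝ)) by fun_prop)
    simpa only [AddCircle.coe_add] using h1 s₁
  refine (key s₀).hasDerivAt.congr_deriv ?_
  have h2 : (fun s : ℝ => φ ((x : T1) + (s₀ : T1) + (s : T1), ω)) =
      fun s : ℝ => (fun s' : ℝ => φ ((x : T1) + (s' : T1), ω)) (s₀ + s) := by
    funext s
    simp only [AddCircle.coe_add, add_assoc]
  change _ = deriv (fun s : ℝ => φ ((x : T1) + (s₀ : T1) + (s : T1), ω)) 0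
  rw [h2, deriv_comp_const_add (fun s' : ℝ => φ ((x : T1) + (s' : T1), ω)), add_zero]

/-- Continuity may be checked on the universal cover `ℝ × ℝ`, where the angular derivative is a
directional derivative of a `C¹` function. -/
lemma continuous_angleDeriv (hφ : IsTestFunction φ) : Continuous (angleDeriv φ) := by
  have hq : IsOpenQuotientMap (Prod.map ((↑) : ℝ → T1) (id : ℝ → ℝ)) :=
    (QuotientAddGroup.isOpenQuotientMap_mk).prodMap .id
  rw [hq.isQuotientMap.continuous_iff]
  have h1 : angleDeriv φ ∘ Prod.map ((↑) : ℝ → T1) (id : ℝ → ℝ) =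
      fun p : ℝ × ℝ => fderiv ℝ (fun p : ℝ × ℝ => φ ((p.1 : T1), p.2)) p (1, 0) := by
    funext ⟨x, ω⟩
    have h2 : HasDerivAt (fun s : ℝ => ((x + s, ω) : ℝ × ℝ)) (1, 0) 0 :=
      ((hasDerivAt_id (0 : ℝ)).const_add x).prodMk (hasDerivAt_const 0 ω)
    have h3 := (hφ.1.differentiable one_ne_zero (x, ω)).hasFDerivAt
    have h4 : HasDerivAt (fun s : ℝ => φ (((x + s : ℝ) : T1), ω)) _ 0 :=
      HasFDerivAt.comp_hasDerivAt_of_eq (l := fun p : ℝ × ℝ => φ ((p.1 : T1), p.2))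
        (0 : ℝ) h3 h2 (by simp)
    simp only [AddCircle.coe_add] at h4
    exact h4.deriv
  rw [h1]
  exact (hφ.1.continuous_fderiv one_ne_zero).clm_apply continuous_const

lemma hasCompactSupport_angleDeriv (hφ : IsTestFunction φ) :
    HasCompactSupport (angleDeriv φ) := by
  refine hφ.2.mono' fun p hp => ?_
  by_contra hcon
  refine hp ?_
  have h1 : ∀ᶠ q in 𝓝 p, φ q = 0 := notMem_tsupport_iff_eventuallyEq.1 hcon
  have h2 : ContinuousAt (fun s : ℝ => ((p.1 + (s : T1), p.2) : Cyl)) 0 := by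
    have := AddCircle.continuous_mk' (2 * Real.pi)
    exact Continuous.continuousAt (by fun_prop)
  have h3 : (fun s : ℝ => φ (p.1 + (s : T1), p.2)) =ᶠ[𝓝 0] fun _ => 0 :=
    h2.eventually (p := fun q => φ q = 0) (by simpa using h1)
  rw [angleDeriv, h3.deriv_eq, deriv_const]

lemma continuous_of_isTestFunction (hφ : IsTestFunction φ) : Continuous φ := by
  have hq : IsOpenQuotientMap (Prod.map ((↑) : ℝ → T1) (id : ℝ → ℝ)) :=
    (QuotientAddGroup.isOpenQuotientMap_mk).prodMap .id
  rw [hq.isQuotientMap.continuous_iff]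
  exact hφ.1.continuous

/-- The integral over the circle of the derivative of a periodic function vanishes. -/
lemma integral_angleDeriv (hφ : IsTestFunction φ) (η : T1) (ω : ℝ) :
    ∫ θ : T1, angleDeriv φ (θ + η, ω) = 0 := by
  rw [integral_add_right_eq_self (fun θ : T1 => angleDeriv φ (θ, ω)),
    ← AddCircle.intervalIntegral_preimage (2 * Real.pi) 0]
  have h1 := fun s : ℝ => hasDerivAt_angle hφ (0, ω) s
  simp only [zero_add] at h1 ⊢
  rw [intervalIntegral.integral_eq_sub_of_hasDerivAt (fun s _ => h1 s)]
  · simp [AddCircle.coe_period]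
  · have h2 := continuous_angleDeriv hφ
    have := AddCircle.continuous_mk' (2 * Real.pi)
    exact Continuous.intervalIntegrable (by fun_prop) _ _

/-- Stationarity of the conditional law of the phase under `θ' = x - a sin θ`: the velocity vanishes
at the locked phase, and velocity times density is constant in `θ` for a drifting oscillator. -/
lemma integral_flux_phaseKernel (hφ : IsTestFunction φ) {a : ℝ} (ha : 0 < a) (η : T1) (x ω : ℝ) :
    ∫ θ, (x - a * sinT θ) * angleDeriv φ (θ + η, ω) ∂(phaseKernel a x) = 0 := by
  rcases le_or_gt |x| a with hx | hx
  · have h1 := abs_le.1 hx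
    rw [phaseKernel_of_abs_le hx, integral_dirac, sinT_coe, Real.sin_arcsin]
    · field_simp
      simp
    · rw [le_div_iff₀ ha]; linarith
    · rw [div_le_iff₀ ha]; linarith
  · rw [integral_phaseKernel_of_lt_abs hx]
    -- the velocity of a drifting oscillator has the constant sign of `x`
    have hsign : ∀ θ : T1, x - a * sinT θ = SignType.sign x * |x - a * sinT θ| := by
      intro θ
      have h2 := abs_lt.1 (abs_mul_sinT_lt ha hx θ)
      rcases lt_trichotomy x 0 with h0 | h0 | h0
      · rw [abs_of_neg h0] at h2
        rw [sign_neg h0, abs_of_neg (by linarith)]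
        simp
      · rw [h0, abs_zero] at hx
        linarith
      · rw [abs_of_pos h0] at h2
        rw [sign_pos h0, abs_of_pos (by linarith)]
        simp
    have h3 : ∀ θ : T1, driftDensity a x θ • ((x - a * sinT θ) * angleDeriv φ (θ + η, ω)) =
        SignType.sign x * (Real.sqrt (x ^ 2 - a ^ 2) / (2 * Real.pi)) *
          angleDeriv φ (θ + η, ω) := by
      intro θ
      have h4 := abs_pos.2 (sub_mul_sinT_ne_zero ha hx θ)
      rw [hsign θ, driftDensity, smul_eq_mul]
      field_simp
    simp only [h3]
    rw [integral_const_mul, integral_angleDeriv hφ, mul_zero]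

end testFunction

/-! ### Self-consistent profiles are partially locked states -/

section weakSolution

variable {a Ω K r : ℝ} {g : ℝ → ℝ}

lemma integral_galilean_zero (f : Measure Cyl) (Θ : T1) {ψ : Cyl → ℝ} (hψ : Continuous ψ) :
    ∫ p, ψ p ∂(galilean Θ 0 f) = ∫ p, ψ (p.1 + Θ, p.2) ∂f := by
  rw [galilean, integral_map (measurable_galilean Θ 0).aemeasurable hψ.aestronglyMeasurable]
  simp only [add_zero]

/-- The rotation of the profile and the rotation of the mean field compensate: at a rotated point
the velocity is that of the unrotated profile. -/
lemma velocity_galilean {f : Measure Cyl} [IsFiniteMeasure f] (hf : orderParameter f = r)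
    (Θ : T1) (p : Cyl) :
    velocity K (galilean Θ 0 f) (p.1 + Θ, p.2) = p.2 - K * r * sinT p.1 := by
  have hc := continuous_sinT
  have h1 : ∀ q : Cyl, sinT (q.1 + Θ - (p.1 + Θ)) = (expT q.1 * expT (-p.1)).im := fun q => by
    rw [← expT_add, expT_im]
    congr 1
    abel
  have h2 : ∫ q : Cyl, (expT q.1 * expT (-p.1)).im ∂f = (r * expT (-p.1)).im := by
    have h3 : Integrable (fun q : Cyl => expT q.1 * expT (-p.1)) f :=
      integrable_expT_fst.mul_const _
    have h4 := integral_im h3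
    simp only [RCLike.im_to_complex] at h4
    rw [h4, integral_mul_const, ← hf, orderParameter]
  rw [velocity, integral_galilean_zero f Θ (by fun_prop)]
  simp only [h1]
  rw [h2, im_ofReal_mul, expT_im, sinT_neg]
  ring

/-- Self-consistency of the order parameter suffices for the rotating profile to solve the Kuramoto
equation. -/
theorem isWeakSolution_rotatingFs (hK : 0 < K) (hr : 0 < r) (hg : Measurable g)
    [IsProbabilityMeasure (densityMeasure (fun ω => g (ω + Ω)))]
    (hord : orderParameter (rotatingFs (K * r) Ω g) = r) :
    IsWeakSolution K (fun t => galilean ((Ω * t : ℝ) : T1) 0 (rotatingFs (K * r) Ω g)) := by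
  have ha : 0 < K * r := mul_pos hK hr
  have hprob := isProbabilityMeasure_rotatingFs (Ω := Ω) ha hg
  set f := rotatingFs (K * r) Ω g with hf
  refine ⟨fun t _ => Measure.isProbabilityMeasure_map (measurable_galilean _ _).aemeasurable,
    fun φ hφ t _ => ?_⟩
  have hcφ := continuous_of_isTestFunction hφ
  have hcd := continuous_angleDeriv hφ
  have hcs := continuous_sinT
  obtain ⟨C, hC⟩ := hcd.bounded_above_of_compact_support (hasCompactSupport_angleDeriv hφ)
  have hCi : Integrable (fun p : Cyl => angleDeriv φ (p.1 + ((Ω * t : ℝ) : T1), p.2)) f :=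
    Integrable.of_bound (C := C) (Continuous.aestronglyMeasurable (by fun_prop))
      (Eventually.of_forall fun p => hC _)
  have hder : HasDerivAt (fun s : ℝ => ∫ p, φ (p.1 + ((Ω * s : ℝ) : T1), p.2) ∂f)
      (∫ p, angleDeriv φ (p.1 + ((Ω * t : ℝ) : T1), p.2) * Ω ∂f) t := by
    refine (hasDerivAt_integral_of_dominated_loc_of_deriv_le (s := univ)
      (F' := fun s (p : Cyl) => angleDeriv φ (p.1 + ((Ω * s : ℝ) : T1), p.2) * Ω)
      (bound := fun _ => C * |Ω|) univ_mem ?_ ?_ ?_ ?_ (integrable_const _) ?_).2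
    · exact Eventually.of_forall fun s => Continuous.aestronglyMeasurable (by fun_prop)
    · obtain ⟨C', hC'⟩ := hcφ.bounded_above_of_compact_support hφ.2
      exact Integrable.of_bound (C := C') (Continuous.aestronglyMeasurable (by fun_prop))
        (Eventually.of_forall fun p => hC' _)
    · exact Continuous.aestronglyMeasurable (by fun_prop)
    · refine Eventually.of_forall fun p s _ => ?_
      rw [norm_mul, Real.norm_eq_abs Ω]
      exact mul_le_mul_of_nonneg_right (hC _) (abs_nonneg _)
    · refine Eventually.of_forall fun p s _ => ?_
      have h1 := hasDerivAt_angle hφ p (Ω * s)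
      have h2 : HasDerivAt (fun s : ℝ => Ω * s) Ω s := by
        simpa using (hasDerivAt_id s).const_mul Ω
      exact h1.comp s h2
  -- the angular velocity in the rotating frame, against the derivative of the test function
  have hflux : Integrable (fun p : Cyl => (p.2 - Ω - K * r * sinT p.1) *
      angleDeriv φ (p.1 + ((Ω * t : ℝ) : T1), p.2)) f := by
    refine Continuous.integrable_of_hasCompactSupport (by fun_prop) ?_
    refine HasCompactSupport.mul_left (f' := fun p : Cyl =>
      angleDeriv φ (p.1 + ((Ω * t : ℝ) : T1), p.2)) ?_
    exact (hasCompactSupport_angleDeriv hφ).comp_homeomorph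
      ((Homeomorph.addRight ((Ω * t : ℝ) : T1)).prodCongr (Homeomorph.refl ℝ))
  have hzero : ∫ p, (p.2 - Ω - K * r * sinT p.1) *
      angleDeriv φ (p.1 + ((Ω * t : ℝ) : T1), p.2) ∂f = 0 := by
    rw [hf, integral_rotatingFs ha hg hflux]
    simp only [add_sub_cancel_right, integral_flux_phaseKernel hφ ha, integral_zero]
  have hvel : ∀ p : Cyl, velocity K (galilean ((Ω * t : ℝ) : T1) 0 f)
      (p.1 + ((Ω * t : ℝ) : T1), p.2) = p.2 - K * r * sinT p.1 := velocity_galilean hord _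
  have hvc : Continuous (velocity K (galilean ((Ω * t : ℝ) : T1) 0 f)) := by
    have : velocity K (galilean ((Ω * t : ℝ) : T1) 0 f) =
        fun p => p.2 - K * r * sinT (p.1 - ((Ω * t : ℝ) : T1)) := by
      funext p
      have := hvel (p.1 - ((Ω * t : ℝ) : T1), p.2)
      simpa only [sub_add_cancel] using this
    rw [this]
    fun_prop
  simp only [integral_galilean_zero f _ hcφ]
  rw [integral_galilean_zero f _ (ψ := fun p => velocity K _ p * angleDeriv φ p) (hvc.mul hcd)]
  refine (hder.congr_deriv ?_).hasDerivWithinAt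
  simp only [hvel]
  -- the two sides differ by the flux integral `hzero`
  rw [← sub_eq_zero, ← neg_eq_zero, neg_sub, ← hzero, ← integral_sub]
  · refine integral_congr_ae (Eventually.of_forall fun p => ?_)
    ring
  · refine (hflux.add (hCi.mul_const Ω)).congr (Eventually.of_forall fun p => ?_)
    simp only [Pi.add_apply]
    ring
  · exact hCi.mul_const Ω

end weakSolution

/-- If the homogeneous state violates the stability condition at a point with `Re z > 0`, some
rotating profile is a partially locked state. -/
theorem exists_isPLS_rotatingFs {K : ℝ} (hK : 0 ≤ K) {g : ℝ → ℝ} (hg_nonneg : ∀ ω, 0 ≤ g ω)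
    (hg : Measurable g) (hg_int : Integrable g) (hg_one : ∫ ω, g ω = 1) {z₀ : ℂ} (hz₀ : 0 < z₀.re)
    (hz : ¬ StabHomogAt K g z₀) :
    ∃ Ω r : ℝ, 0 < r ∧ IsPLS K Ω (rotatingFs (K * r) Ω g) ∧
      orderParameter (rotatingFs (K * r) Ω g) = (r : ℂ) ∧
      frequencyMarginal (rotatingFs (K * r) Ω g) = densityMeasure g := by
  have hprob := isProbabilityMeasure_densityMeasure hg_nonneg hg_int hg_one
  rw [StabHomogAt, not_not, integral_fourier_mul_exp hg_nonneg hg hg_int hz₀] at hz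
  -- for `K = 0` the stability condition `0 ≠ 1` holds everywhere
  have hKpos : 0 < K := by
    refine lt_of_le_of_ne hK fun h => ?_
    simp [← h] at hz
  have hKc : (K : ℂ) ≠ 0 := by exact_mod_cast hKpos.ne'
  have hz' : lockTransform (densityMeasure g) 0 z₀ = ((1 / K : ℝ) : ℂ) := by
    push_cast
    rw [eq_div_iff hKc]
    linear_combination hz
  obtain ⟨a, Ω, ha, hΩ⟩ := exists_lockTransform_eq_on_boundary hKpos hz₀ hz'
  have hprobΩ := isProbabilityMeasure_comp_add hg_nonneg hg_int hg_one Ω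
  have haK : K * (a / K) = a := by field_simp
  have hr : 0 < a / K := div_pos ha hKpos
  have hord : orderParameter (rotatingFs (K * (a / K)) Ω g) = ((a / K : ℝ) : ℂ) := by
    rw [haK, orderParameter_rotatingFs ha hg, hΩ, Complex.conj_ofReal]
    push_cast
    ring
  refine ⟨Ω, a / K, hr, ⟨isWeakSolution_rotatingFs hKpos hr hg hord, ?_⟩, hord, ?_⟩
  · rw [hord]
    exact_mod_cast hr.ne'
  · rw [haK]
    exact frequencyMarginal_rotatingFs ha hg

end Kuramoto

end

theorem mainTheorem3 (K : ℝ) (hK : 0 ≤ K) (g : ℝ → ℝ)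
    (hg_nonneg : ∀ ω, 0 ≤ g ω)
    (hg_int : MeasureTheory.Integrable g)
    (hg_one : ∫ ω, g ω = 1)
    (hg_lip : ∃ L : NNReal, LipschitzWith L g)
    (hg_fourier : MeasureTheory.IntegrableOn
      (fun τ : ℝ => (1 + τ) * ‖Kuramoto.fourier g τ‖) (Set.Ioi 0))
    (hfail : ∃ z : ℂ, 0 < z.re ∧ ¬ Kuramoto.StabHomogAt K g z) :
    ∃ Ω r : ℝ, 0 < r ∧
      Kuramoto.IsPLS K Ω (Kuramoto.rotatingFs (K * r) Ω g) ∧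
      Kuramoto.orderParameter (Kuramoto.rotatingFs (K * r) Ω g) = (r : ℂ) ∧
      Kuramoto.frequencyMarginal (Kuramoto.rotatingFs (K * r) Ω g) =
        Kuramoto.densityMeasure g := by
  obtain ⟨L, hL⟩ := hg_lip
  obtain ⟨z₀, hz₀, hz⟩ := hfail
  exact Kuramoto.exists_isPLS_rotatingFs hK hg_nonneg hL.continuous.measurable hg_int hg_one hz₀ hz
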